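/- Let $\theta$ be an irrational number, $\alpha=e^{2\pi i\theta}$, and let $u,v$ be unitaries in a nonzero unital $C^*$-algebra $B$ with $vu=\alpha uv$ (for instance, two such unitary generators of the hyperfinite ${\rm II}_1$ factor). For $f\in C(S^1)$ let $f(v)$ be given by the continuous functional calculus, and let $C^*(uf(v),1)\subseteq B$ be the $C^*$-algebra generated by $uf(v)$ and the identity. For a real function $\gamma\in C(S^1)$, $\gamma\ge 0$, and $\eta\in\mathbb R$, let $A_{\eta,\gamma}$ be the universal unital $C^*$-algebra generated by $x$ and $w$ subject to $$w^*w=ww^*=1,\quad x^*x=\gamma(w),\quad xx^*=\gamma(e^{-2\pi i\eta}w),\quad xw=e^{-2\pi i\eta}wx;$$ when $\eta$ is irrational it is called a generalized universal irrational rotation $C^*$-algebra. Let $\phi(z)=\alpha z$ on $S^1$. A function $h$ on $S^1$ is periodic if there is $\zeta\in S^1$, $\zeta\neq 1$, with $h(\zeta z)=h(z)$ for all $z\in S^1$. **Theorem.** Let $f\in C(S^1)$ have a nonempty zero set $Y$ that satisfies one of the following (equivalent) conditions: (1) $\phi^n(Y)\cap Y=\emptyset$ for every integer $n\ne 0$;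 (2) for each $\xi\in S^1$ the orbit $\{\phi^n(\xi):n\in\mathbb Z\}$ meets $Y$ in at most one point; (3) $\bigcup_{n\ge 0}\phi^n(Y)$ and $\bigcup_{k\ge 1}\phi^{-k}(Y)$ are disjoint. Then $C^*(uf(v),1)$ is $*$-isomorphic to a generalized universal irrational rotation $C^*$-algebra. More precisely: (a) if $|f|$ is not periodic, then $C^*(uf(v),1)\cong A_{\theta,|f|^2}$; (b) if $|f|$ is periodic, then there are an integer $n\ge 2$ and a continuous function $g\ge 0$ on $S^1$ such that the periods of $|f|$ (the $\zeta\in S^1$ with $|f|(\zeta z)=|f|(z)$ for all $z$) are exactly the $n$-th roots of unity, $|f|(z)=g(z^n)$ for all $z\in S^1$, and $C^*(uf(v),1)\cong A_{n\theta,g^2}$. -/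

import Mathlib

open scoped ENNReal

universe u

noncomputable section

namespace RotAlg

/-! ### Continuous functions of a unitary -/

section Calculus

variable {B : Type*} [CStarAlgebra B]

/-- The inclusion of the spectrum of a unitary into the unit circle. -/
def spectrumToCircle (v : unitary B) : C(spectrum ℂ (v : B), Circle) where
  toFun z := ⟨z, by
    have h := spectrum.subset_circle_of_unitary v.2 z.2
    exact mem_sphere_zero_iff_norm.mpr (by simpa using h)⟩
  continuous_toFun := by
    exact Continuous.subtype_mk continuous_subtype_val _

/-- The continuous functional calculus `f ↦ f(v)` of a unitary `v`,
for `f` a continuous function on the unit circle. -/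
def fc (v : unitary B) : C(Circle, ℂ) →⋆ₐ[ℂ] B :=
  (cfcHom (Unitary.coe_isStarNormal v)).comp
    (ContinuousMap.compStarAlgHom' ℂ ℂ (spectrumToCircle v))

open Classical in
theorem fc_eq_cfc (v : unitary B) (f : C(Circle, ℂ)) :
    fc v f = cfc (fun z : ℂ => if h : z ∈ Submonoid.unitSphere ℂ then f ⟨z, h⟩ else 0) (v : B) ∧
    ContinuousOn (fun z : ℂ => if h : z ∈ Submonoid.unitSphere ℂ then f ⟨z, h⟩ else 0)
      (Metric.sphere 0 1) := by
  set F : ℂ → ℂ := fun z : ℂ => if h : z ∈ Submonoid.unitSphere ℂ then f ⟨z, h⟩ else 0 with hF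
  have hc : ContinuousOn F (Metric.sphere 0 1) := by
    rw [continuousOn_iff_continuous_domRestrict]
    have : (Metric.sphere (0 : ℂ) 1).domRestrict F =
        fun z : Metric.sphere (0 : ℂ) 1 => f ⟨(z : ℂ), z.2⟩ := by
      funext z
      have hz : (z : ℂ) ∈ Submonoid.unitSphere ℂ := z.2
      exact dif_pos hz
    rw [this]
    exact f.continuous.comp (Continuous.subtype_mk continuous_subtype_val _)
  refine ⟨?_, hc⟩
  rw [cfc_apply F (v : B) (Unitary.coe_isStarNormal v)
    (hc.mono (spectrum.subset_circle_of_unitary v.2))]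
  simp only [fc, StarAlgHom.comp_apply]
  congr 1
  ext z
  have hz : (z : ℂ) ∈ Submonoid.unitSphere ℂ := spectrum.subset_circle_of_unitary v.2 z.2
  change f ⟨(z : ℂ), hz⟩ = F z
  simp only [hF, hz, dite_true]

theorem continuous_starAlgHom {C : Type*} [CStarAlgebra C] (φ : B →⋆ₐ[ℂ] C) : Continuous φ :=
  AddMonoidHomClass.continuous_of_bound φ 1
    (by simpa only [one_mul] using NonUnitalStarAlgHom.norm_apply_le φ)

theorem map_fc {C : Type*} [CStarAlgebra C] (φ : B →⋆ₐ[ℂ] C) (v : unitary B) (v' : unitary C)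
    (h : φ v = v') (f : C(Circle, ℂ)) : φ (fc v f) = fc v' f := by
  obtain ⟨h1, hc⟩ := fc_eq_cfc v f
  rw [h1, (fc_eq_cfc v' f).1, ← h]
  have hn : IsStarNormal (φ (v : B)) := by rw [h]; exact Unitary.coe_isStarNormal v'
  exact StarAlgHom.map_cfc φ _ _ (hc.mono (spectrum.subset_circle_of_unitary v.2))
    (continuous_starAlgHom φ) (Unitary.coe_isStarNormal v) hn

end Calculus

/-! ### Functions on the circle -/

/-- A real continuous function on the circle, viewed as a complex one. -/
def toC (γ : C(Circle, ℝ)) : C(Circle, ℂ) := ⟨fun z => (γ z : ℂ), by fun_prop⟩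

/-- The function `|f|²`. -/
def absSq (f : C(Circle, ℂ)) : C(Circle, ℝ) := ⟨fun z => ‖f z‖ ^ 2, by fun_prop⟩

/-- The number `α = e^{2πiθ}`. -/
def alpha (θ : ℝ) : Circle := Circle.exp (2 * Real.pi * θ)

/-- The function `z ↦ h(ζ z)`. -/
def translate (ζ : Circle) (h : C(Circle, ℂ)) : C(Circle, ℂ) := ⟨fun z => h (ζ * z), by fun_prop⟩

/-- `ζ` is a period of `h`. The trivial period `1` is allowed. -/
def IsPeriod (h : Circle → ℝ) (ζ : Circle) : Prop := ∀ z, h (ζ * z) = h z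

/-- `h` is a periodic function: it has a nontrivial period. -/
def Periodic (h : Circle → ℝ) : Prop := ∃ ζ : Circle, ζ ≠ 1 ∧ IsPeriod h ζ

/-- The set `φⁿ(Y)`, where `φ(z) = e^{2πiθ} z`. -/
def rot (θ : ℝ) (n : ℤ) (Y : Set Circle) : Set Circle := (fun z => alpha θ ^ n * z) '' Y

/-- The orbit of `ξ` under the rotation `φ(z) = e^{2πiθ} z`. -/
def orb (θ : ℝ) (ξ : Circle) : Set Circle := {z | ∃ n : ℤ, z = alpha θ ^ n * ξ}

/-! ### Generalized universal irrational rotation C*-algebras -/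

/-- The defining relations: `w` is unitary and
`x* x = γ(w)`, `x x* = γ(e^{-2πiθ} w)`, `x w = e^{-2πiθ} w x`. -/
structure Relations (θ : ℝ) (γ : C(Circle, ℝ)) {B : Type*} [CStarAlgebra B]
    (x : B) (w : unitary B) : Prop where
  star_mul : star x * x = fc w (toC γ)
  mul_star : x * star x = fc w (translate (alpha θ)⁻¹ (toC γ))
  comm : x * (w : B) = (((alpha θ)⁻¹ : Circle) : ℂ) • ((w : B) * x)

/-- A nonzero unital C*-algebra with a pair `(x, w)` that satisfies the relations. -/
structure Model (θ : ℝ) (γ : C(Circle, ℝ)) : Type (u + 1) where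
  carrier : Type u
  [cstar : CStarAlgebra carrier]
  [nontriv : Nontrivial carrier]
  x : carrier
  w : unitary carrier
  rel : Relations θ γ x w

attribute [instance] Model.cstar Model.nontriv

variable (θ : ℝ) (γ : C(Circle, ℝ))

/-- The C*-algebra of all bounded families indexed by the models, with the sup norm. -/
abbrev Big : Type (u + 1) := lp (fun i : Model.{u} θ γ => i.carrier) ∞

instance : CStarAlgebra (Big.{u} θ γ) where

theorem norm_x_le (i : Model.{u} θ γ) : ‖i.x‖ ≤ ‖toC γ‖ + 1 := by
  have h : ‖i.x‖ * ‖i.x‖ ≤ ‖toC γ‖ := by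
    rw [← CStarRing.norm_star_mul_self, i.rel.star_mul]
    exact NonUnitalStarAlgHom.norm_apply_le (fc i.w) (toC γ)
  nlinarith [norm_nonneg i.x, norm_nonneg (toC γ)]

/-- The family of all `x`. -/
def bigX : Big.{u} θ γ :=
  ⟨fun i => i.x, memℓp_infty ⟨‖toC γ‖ + 1, by rintro _ ⟨i, rfl⟩; exact norm_x_le θ γ i⟩⟩

/-- The family of all `w`. -/
def bigW : Big.{u} θ γ :=
  ⟨fun i => i.w, memℓp_infty ⟨1, by
    rintro _ ⟨i, rfl⟩
    exact (CStarRing.norm_coe_unitary i.w).le⟩⟩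

/-- The generalized universal rotation C*-algebra `A_{θ,γ}`: the universal C*-algebra generated by
`x` and `w` subject to the relations, built as the C*-algebra generated by the
family of all pairs that satisfy them. -/
def GenRotAlg : StarSubalgebra ℂ (Big.{u} θ γ) :=
  (StarAlgebra.adjoin ℂ {bigX.{u} θ γ, bigW.{u} θ γ}).topologicalClosure

instance : CStarAlgebra (GenRotAlg.{u} θ γ) :=
  StarSubalgebra.cstarAlgebra _ (h_closed := StarSubalgebra.isClosed_topologicalClosure _)

/-- The generator `x` of `A_{θ,γ}`. -/
def genX : GenRotAlg.{u} θ γ :=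
  ⟨bigX θ γ, StarSubalgebra.le_topologicalClosure _ (StarAlgebra.subset_adjoin _ _ (by simp))⟩

theorem bigW_mem : bigW.{u} θ γ ∈ unitary (Big.{u} θ γ) := by
  constructor
  · ext i; exact Unitary.coe_star_mul_self i.w
  · ext i; exact Unitary.coe_mul_star_self i.w

/-- The generator `w` of `A_{θ,γ}`. -/
def genW : unitary (GenRotAlg.{u} θ γ) :=
  ⟨⟨bigW θ γ, StarSubalgebra.le_topologicalClosure _
      (StarAlgebra.subset_adjoin _ _ (by simp))⟩,
    ⟨Subtype.ext (bigW_mem θ γ).1, Subtype.ext (bigW_mem θ γ).2⟩⟩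

/-- The component at a model, as a *-homomorphism. -/
def proj (i : Model.{u} θ γ) : Big.{u} θ γ →⋆ₐ[ℂ] i.carrier where
  toFun a := a i
  map_one' := rfl
  map_mul' _ _ := rfl
  map_zero' := rfl
  map_add' _ _ := rfl
  commutes' _ := rfl
  map_star' _ := rfl

/-- The generators of `A_{θ,γ}` satisfy the relations. -/
theorem relations_gen : Relations θ γ (genX.{u} θ γ) (genW.{u} θ γ) := by
  have key : ∀ (a : GenRotAlg.{u} θ γ) (h : C(Circle, ℂ)),
      (∀ i, proj θ γ i a = fc i.w h) → a = fc (genW.{u} θ γ) h := by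
    intro a h ha
    apply Subtype.ext
    ext i
    exact (ha i).trans (map_fc ((proj θ γ i).comp (GenRotAlg θ γ).subtype) (genW θ γ) i.w rfl h).symm
  refine ⟨key _ _ fun i => i.rel.star_mul, key _ _ fun i => i.rel.mul_star, ?_⟩
  apply Subtype.ext
  ext i
  exact i.rel.comm

/-- The universal property of `A_{θ,γ}`. -/
theorem existsUnique_lift {B : Type u} [CStarAlgebra B] (x : B) (w : unitary B)
    (h : Relations θ γ x w) :
    ∃! φ : GenRotAlg.{u} θ γ →⋆ₐ[ℂ] B, φ (genX θ γ) = x ∧ φ (genW θ γ : GenRotAlg.{u} θ γ) = w := by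
  have ex : ∃ φ : GenRotAlg.{u} θ γ →⋆ₐ[ℂ] B, φ (genX θ γ) = x ∧ φ (genW θ γ : GenRotAlg.{u} θ γ) = w := by
    cases subsingleton_or_nontrivial B with
    | inl hB =>
      exact ⟨{ toFun := fun _ => 0
               map_one' := Subsingleton.elim _ _
               map_mul' := fun _ _ => Subsingleton.elim _ _
               map_zero' := Subsingleton.elim _ _
               map_add' := fun _ _ => Subsingleton.elim _ _
               commutes' := fun _ => Subsingleton.elim _ _
               map_star' := fun _ => Subsingleton.elim _ _ },
        Subsingleton.elim _ _, Subsingleton.elim _ _⟩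
    | inr hB =>
      exact ⟨(proj θ γ ⟨B, x, w, h⟩).comp (GenRotAlg θ γ).subtype, rfl, rfl⟩
  obtain ⟨φ, hφ⟩ := ex
  refine ⟨φ, hφ, fun ψ hψ => ?_⟩
  refine StarAlgHom.ext_topologicalClosure (continuous_starAlgHom ψ) (continuous_starAlgHom φ) ?_
  refine StarAlgHom.ext_adjoin fun y hy => ?_
  obtain ⟨y, hy'⟩ := y
  rcases hy with hy | hy
  · subst hy
    exact hψ.1.trans hφ.1.symm
  · obtain rfl : y = bigW θ γ := hy
    exact hψ.2.trans hφ.2.symm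

end RotAlg

end

/-!
The element `x = u f(v)` and the unitary `w = v` satisfy the relations of `A_{θ,|f|²}`. The proof
has two independent halves, both about a pair `(x, w)` that satisfies the relations of
`A_{θ,γ}` with `θ` irrational; they are joined in `nonempty_elemental_equiv`.

*Recovering `w` from `x`* (`fc_mem_elemental`). The functions `h` with `h(w) ∈ C*(x, 1)` form a
closed `*`-subalgebra `S` of `C(S¹)`. Since `x* x = γ(w)` and `x* h(w) x = γ(w) h(αw)`, and
similarly for `x x*` and `x h(w) x*`, two points that `S` does not separate stay unseparated when
they are rotated forward, as long as the orbit avoids the zeros of `γ`, and likewise backward.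
An orbit meets the zero set at most once, so it has a half that avoids it. Half-orbits are dense,
hence the quotient of the two points is a period of `γ`. If `γ` has no nontrivial period,
`S` separates points, and `S = C(S¹)` by Stone–Weierstrass.

*Faithfulness* (`injective_of_injective_fc`). The representation `A_{θ,γ} → C*(x, w)` is injective
as soon as it is so on the functions of the unitary generator `W`. Conjugation by `W` multiplies
`h(W) Xⁿ` by `αⁿ`, so its Cesàro means converge to a conditional expectation `E` onto the
functions of `W`. If `a` is mapped to `0`, then so is `E(a* a)`, and `E(a* a) = 0`.
The expectation is faithful: conjugation by `Wᵏ` moves `a* a` little whenever `αᵏ` is close to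
`1`, and such `k` occur with bounded gaps, so `E(a* a)` dominates a positive multiple
of `a* a - ε` (`norm_le_of_recurrent`). For `w = v` the hypothesis holds because
`u* v u = α v` makes the spectrum of `v` invariant under an irrational rotation (`fc_injective`).

If `|f|` is periodic, its periods form a proper closed subgroup of the circle, thus the group of
`n`-th roots of unity, and `|f|(z) = g(zⁿ)`. The pair `(x, vⁿ)` satisfies the relations of
`A_{nθ,g²}`, and `g` has no nontrivial period, so that both halves apply to it.
-/

namespace RotAlg

/-! ### Irrational rotations of the circle -/

theorem alpha_natCast_mul (n : ℕ) (θ : ℝ) : alpha (n * θ) = alpha θ ^ n := by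
  induction n with
  | zero => simp [alpha]
  | succ k ih =>
    rw [pow_succ, ← ih, alpha, alpha, alpha, ← Circle.exp_add]
    congr 1
    push_cast
    ring

theorem denseRange_alpha_zpow {θ : ℝ} (hθ : Irrational θ) :
    DenseRange (fun k : ℤ => alpha θ ^ k) := by
  have h1 : DenseRange (fun k : ℤ => k • (θ : AddCircle (1 : ℝ))) :=
    AddCircle.denseRange_zsmul_coe_iff.mpr (by simpa using hθ)
  have h2 := (AddCircle.homeomorphCircle (T := (1 : ℝ)) one_ne_zero).surjective.denseRange.comp h1
    (AddCircle.homeomorphCircle (T := (1 : ℝ)) one_ne_zero).continuous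
  convert h2 using 2 with k
  simp [AddCircle.homeomorphCircle_apply, AddCircle.toCircle_zsmul, AddCircle.toCircle_apply_mk,
    alpha]

theorem denseRange_alpha_pow {θ : ℝ} (hθ : Irrational θ) :
    DenseRange (fun k : ℕ => alpha θ ^ k) :=
  denseRange_zpow_iff_pow.mp (denseRange_alpha_zpow hθ)

theorem denseRange_alpha_inv_pow {θ : ℝ} (hθ : Irrational θ) :
    DenseRange (fun k : ℕ => (alpha θ)⁻¹ ^ k) := by
  have h : alpha (-θ) = (alpha θ)⁻¹ := by rw [alpha, alpha, ← Circle.exp_neg, mul_neg]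
  exact h ▸ denseRange_alpha_pow hθ.neg

theorem alpha_zpow_ne_one {θ : ℝ} (hθ : Irrational θ) {k : ℤ} (hk : k ≠ 0) :
    alpha θ ^ k ≠ 1 := by
  rw [alpha, ← Circle.exp_zsmul, Ne, Circle.exp_eq_one]
  rintro ⟨n, hn⟩
  refine (hθ.intCast_mul hk).ne_int n ?_
  have : (2 * Real.pi) * (k * θ - n) = 0 := by
    rw [zsmul_eq_mul] at hn
    linear_combination hn
  rcases mul_eq_zero.mp this with h | h
  · exact absurd h (by positivity)
  · linarith

/-- The orbit of a point returns to a neighbourhood of `1` within a time that is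
bounded independently of the point. -/
theorem exists_finset_alpha_zpow_mul_mem {θ : ℝ} (hθ : Irrational θ) {U : Set Circle}
    (hU : IsOpen U) (h1 : (1 : Circle) ∈ U) :
    ∃ F : Finset ℤ, ∀ z : Circle, ∃ j ∈ F, alpha θ ^ j * z ∈ U := by
  obtain ⟨F, hF⟩ := isCompact_univ.elim_finite_subcover
    (fun j : ℤ => {z : Circle | alpha θ ^ j * z ∈ U})
    (fun j => hU.preimage (by fun_prop)) (fun z _ => by
      obtain ⟨j, hj⟩ := (denseRange_alpha_zpow hθ).exists_mem_open
        (hU.preimage (f := fun y : Circle => y * z) (by fun_prop)) ⟨z⁻¹, by simpa using h1⟩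
      exact Set.mem_iUnion.mpr ⟨j, hj⟩)
  refine ⟨F, fun z => ?_⟩
  simpa using hF (Set.mem_univ z)

/-- Two points whose one-sided orbits are not separated by `h` differ by a period of `h`. -/
theorem isPeriod_of_forall_pow {h : Circle → ℝ} (hc : Continuous h) {β : Circle}
    (hβ : DenseRange (fun k : ℕ => β ^ k)) {z₁ z₂ : Circle}
    (H : ∀ k : ℕ, h (β ^ k * z₁) = h (β ^ k * z₂)) : IsPeriod h (z₂ / z₁) := by
  have key : (fun z => h (z * z₁)) = fun z => h (z * z₂) :=
    hβ.equalizer (by fun_prop) (by fun_prop) (funext H)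
  intro z
  have := congrFun key (z / z₁)
  simp only [div_mul_cancel] at this
  rw [this]
  congr 1
  rw [div_mul_eq_mul_div, div_mul_eq_mul_div, mul_comm]

/-! ### Periods of a function on the circle -/

/-- The periods of a function form a group. -/
def periodGroup (h : Circle → ℝ) : Subgroup Circle where
  carrier := {ζ | IsPeriod h ζ}
  one_mem' := fun z => by rw [one_mul]
  mul_mem' := fun {a b} ha hb z => by rw [mul_assoc, ha, hb]
  inv_mem' := fun {a} ha z => by rw [← ha, mul_inv_cancel_left]

theorem isClosed_periodGroup {h : Circle → ℝ} (hc : Continuous h) :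
    IsClosed (periodGroup h : Set Circle) := by
  have : (periodGroup h : Set Circle) = ⋂ z, {ζ | h (ζ * z) = h z} := by
    ext ζ
    simp [periodGroup, IsPeriod]
  rw [this]
  exact isClosed_iInter fun z => isClosed_eq (by fun_prop) continuous_const

/-- A proper closed subgroup of the circle is the group of `n`-th roots of unity for some `n`. -/
theorem exists_mem_iff_pow_eq_one {H : Subgroup Circle} (hc : IsClosed (H : Set Circle))
    (hne : H ≠ ⊤) : ∃ n : ℕ, n ≠ 0 ∧ ∀ ζ, ζ ∈ H ↔ ζ ^ n = 1 := by
  let s : AddSubgroup (AddCircle (1 : ℝ)) :=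
    { carrier := {a | AddCircle.toCircle a ∈ H}
      zero_mem' := by simp [H.one_mem]
      add_mem' := fun {a b} ha hb => by
        simp only [Set.mem_ofPred_eq, AddCircle.toCircle_add] at *; exact H.mul_mem ha hb
      neg_mem' := fun {a} ha => by
        simp only [Set.mem_ofPred_eq, AddCircle.toCircle_neg] at *; exact H.inv_mem ha }
  have hs : IsClosed (s : Set (AddCircle (1 : ℝ))) := hc.preimage AddCircle.continuous_toCircle
  have hsurj : Function.Surjective (AddCircle.toCircle (T := (1 : ℝ))) := fun z => by
    obtain ⟨a, ha⟩ := (AddCircle.homeomorphCircle (T := (1 : ℝ)) one_ne_zero).surjective z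
    exact ⟨a, by rwa [AddCircle.homeomorphCircle_apply] at ha⟩
  have hnd : ¬ Dense (s : Set (AddCircle (1 : ℝ))) := fun hd => by
    apply hne
    rw [eq_top_iff]
    intro z _
    obtain ⟨a, rfl⟩ := hsurj z
    have : a ∈ (s : Set (AddCircle (1 : ℝ))) := by
      rw [← hs.closure_eq, hd.closure_eq]; trivial
    exact this
  rw [AddCircle.dense_addSubgroup_iff_ne_zmultiples] at hnd
  push Not at hnd
  obtain ⟨a, ha, hsa⟩ := hnd
  have hmem : ∀ ζ, ζ ∈ H ↔ ∃ m : ℤ, AddCircle.toCircle a ^ m = ζ := fun ζ => by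
    obtain ⟨b, rfl⟩ := hsurj ζ
    have : AddCircle.toCircle b ∈ H ↔ b ∈ s := Iff.rfl
    rw [this, hsa, AddSubgroup.mem_zmultiples_iff]
    simp only [← AddCircle.toCircle_zsmul,
      (AddCircle.injective_toCircle (T := (1 : ℝ)) one_ne_zero).eq_iff]
  have hpow : ∀ l : ℕ, AddCircle.toCircle a ^ l = 1 ↔ addOrderOf a ∣ l := fun l => by
    rw [← AddCircle.toCircle_nsmul, ← AddCircle.toCircle_zero,
      (AddCircle.injective_toCircle (T := (1 : ℝ)) one_ne_zero).eq_iff,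
      addOrderOf_dvd_iff_nsmul_eq_zero]
  refine ⟨addOrderOf a, ha, fun ζ => ⟨fun h => ?_, fun h => ?_⟩⟩
  · obtain ⟨m, rfl⟩ := (hmem ζ).mp h
    rw [← zpow_natCast, ← zpow_mul, mul_comm, zpow_mul, zpow_natCast, (hpow _).mpr dvd_rfl,
      one_zpow]
  · have hprim : IsPrimitiveRoot ((AddCircle.toCircle a : Circle) : ℂ) (addOrderOf a) :=
      ⟨by rw [← Circle.coe_pow, (hpow _).mpr dvd_rfl, Circle.coe_one], fun l hl =>
        (hpow l).mp (Circle.ext (by simpa using hl))⟩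
    have : NeZero (addOrderOf a) := ⟨ha⟩
    obtain ⟨i, -, hi⟩ := hprim.eq_pow_of_pow_eq_one (ξ := (ζ : ℂ))
      (by rw [← Circle.coe_pow, h, Circle.coe_one])
    exact (hmem ζ).mpr ⟨i, Circle.ext (by simpa using hi)⟩

/-- A continuous function that is invariant under the `n`-th roots of unity is a continuous
function of the `n`-th power. -/
theorem exists_eq_comp_pow {n : ℕ} (hn : n ≠ 0) {h : Circle → ℝ} (hc : Continuous h)
    (hp : ∀ ζ : Circle, ζ ^ n = 1 → IsPeriod h ζ) :
    ∃ g : C(Circle, ℝ), ∀ z, h z = g (z ^ n) := by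
  have : NeZero n := ⟨hn⟩
  have hq : Topology.IsQuotientMap (fun z : Circle => z ^ n) :=
    (Circle.isQuotientCoveringMap_npow n).toIsQuotientMap
  let q : C(Circle, Circle) := ⟨fun z => z ^ n, by fun_prop⟩
  have hq' : Topology.IsQuotientMap q := hq
  have hfac : Function.FactorsThrough (⟨h, hc⟩ : C(Circle, ℝ)) q := fun a b hab => by
    have := hp (a / b) (by rw [div_pow, div_eq_one]; exact hab) b
    rwa [div_mul_cancel] at this
  refine ⟨hq'.lift ⟨h, hc⟩ hfac, fun z => ?_⟩
  exact (DFunLike.congr_fun (hq'.lift_comp ⟨h, hc⟩ hfac) z).symm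

end RotAlg

namespace RotAlg

/-! ### The calculus `f ↦ f(v)` and intertwining relations -/

/-- The inclusion of the circle in the complex plane, as a continuous function. -/
noncomputable def coeC : C(Circle, ℂ) := ⟨fun z => (z : ℂ), by fun_prop⟩

/-- The map `z ↦ h(ζ z)` induced by a rotation, as a `*`-homomorphism. -/
noncomputable def translateHom (ζ : Circle) : C(Circle, ℂ) →⋆ₐ[ℂ] C(Circle, ℂ) :=
  ContinuousMap.compStarAlgHom' ℂ ℂ ⟨fun z : Circle => ζ * z, by fun_prop⟩

@[simp]
theorem translateHom_apply (ζ : Circle) (h : C(Circle, ℂ)) : translateHom ζ h = translate ζ h := rfl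

/-- A form of the Stone–Weierstrass theorem for closed subalgebras. -/
theorem eq_top_of_isClosed_of_separatesPoints {S : StarSubalgebra ℂ C(Circle, ℂ)}
    (hc : IsClosed (S : Set C(Circle, ℂ)))
    (hs : ∀ z₁ z₂, (∀ h ∈ S, h z₁ = h z₂) → z₁ = z₂) : S = ⊤ := by
  have h1 : S.SeparatesPoints := fun z₁ z₂ hne => by
    by_contra! H
    exact hne (hs z₁ z₂ fun h hh => H h ⟨h, hh, rfl⟩)
  have h2 := ContinuousMap.starSubalgebra_topologicalClosure_eq_top_of_separatesPoints S h1
  rw [eq_top_iff, ← h2]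
  exact StarSubalgebra.topologicalClosure_minimal le_rfl hc

@[simp]
theorem coeC_apply (z : Circle) : coeC z = z := rfl

theorem coeC_mul_star : coeC * star coeC = 1 := by
  ext z
  simp [Complex.mul_conj]

section

variable {B : Type*} [CStarAlgebra B]

theorem fc_coeC (v : unitary B) : fc v coeC = v := by
  have : IsStarNormal (v : B) := Unitary.coe_isStarNormal v
  have h : (ContinuousMap.compStarAlgHom' ℂ ℂ (spectrumToCircle v)) coeC =
      (ContinuousMap.id ℂ).restrict (spectrum ℂ (v : B)) := rfl
  rw [fc, StarAlgHom.comp_apply, h]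
  exact cfcHom_id (Unitary.coe_isStarNormal v)

/-- An element that intertwines the images of the coordinate function intertwines two
representations of `C(S¹)`. -/
theorem intertwine {φ ψ : C(Circle, ℂ) →⋆ₐ[ℂ] B} {y : B} (hy : y * φ coeC = ψ coeC * y)
    (h : C(Circle, ℂ)) : y * φ h = ψ h * y := by
  have hy' : y * φ (star coeC) = ψ (star coeC) * y := by
    have e1 : ψ (star coeC) * ψ coeC = 1 := by rw [← map_mul, mul_comm, coeC_mul_star, map_one]
    have e2 : φ coeC * φ (star coeC) = 1 := by rw [← map_mul, coeC_mul_star, map_one]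
    calc y * φ (star coeC) = ψ (star coeC) * (ψ coeC * y) * φ (star coeC) := by
          rw [← mul_assoc, e1, one_mul]
      _ = ψ (star coeC) * y * (φ coeC * φ (star coeC)) := by rw [← hy]; simp only [mul_assoc]
      _ = ψ (star coeC) * y := by rw [e2, mul_one]
  let S : StarSubalgebra ℂ C(Circle, ℂ) :=
    { carrier := {h | y * φ h = ψ h * y ∧ y * φ (star h) = ψ (star h) * y}
      mul_mem' := fun {a b} ha hb => by
        constructor
        · rw [map_mul, map_mul, ← mul_assoc, ha.1, mul_assoc, hb.1, mul_assoc]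
        · rw [star_mul, map_mul, map_mul, ← mul_assoc, hb.2, mul_assoc, ha.2, mul_assoc]
      add_mem' := fun {a b} ha hb => by
        constructor
        · rw [map_add, map_add, mul_add, add_mul, ha.1, hb.1]
        · rw [star_add, map_add, map_add, mul_add, add_mul, ha.2, hb.2]
      algebraMap_mem' := fun r => by
        constructor
        · rw [AlgHomClass.commutes, AlgHomClass.commutes, Algebra.commutes]
        · rw [← algebraMap_star_comm, AlgHomClass.commutes, AlgHomClass.commutes,
            Algebra.commutes]
      star_mem' := fun {a} ha => ⟨ha.2, by rw [star_star]; exact ha.1⟩ }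
  have hφ := continuous_starAlgHom φ
  have hψ := continuous_starAlgHom ψ
  have hS : IsClosed (S : Set C(Circle, ℂ)) :=
    (isClosed_eq (by fun_prop) (by fun_prop)).inter (isClosed_eq (by fun_prop) (by fun_prop))
  have htop : S = ⊤ := eq_top_of_isClosed_of_separatesPoints hS fun z₁ z₂ H =>
    Circle.ext (H coeC ⟨hy, hy'⟩)
  have : h ∈ S := htop ▸ StarSubalgebra.mem_top
  exact this.1

theorem starAlgHom_ext_coeC {φ ψ : C(Circle, ℂ) →⋆ₐ[ℂ] B} (hy : φ coeC = ψ coeC) : φ = ψ := by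
  ext h
  simpa using intertwine (y := (1 : B)) (by simpa using hy) h

/-- If `v u = α u v` with `u`, `v` unitary, then `h(v) u = u h(α v)`. -/
theorem fc_mul_unitary {u v : unitary B} {ζ : Circle}
    (huv : (v : B) * (u : B) = (ζ : ℂ) • ((u : B) * (v : B))) (h : C(Circle, ℂ)) :
    (u : B) * fc v (translate ζ h) = fc v h * u := by
  refine intertwine (φ := (fc v).comp (translateHom ζ)) (ψ := fc v) ?_ h
  have : translate ζ coeC = (ζ : ℂ) • coeC := by
    ext z
    simp [translate]
  rw [StarAlgHom.comp_apply, translateHom_apply, this, map_smul, fc_coeC, mul_smul_comm, huv]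

/-- The spectrum of `v` is invariant under an irrational rotation, so it is the full circle. -/
theorem fc_injective [Nontrivial B] {θ : ℝ} (hθ : Irrational θ) {u v : unitary B}
    (huv : (v : B) * (u : B) = (alpha θ : ℂ) • ((u : B) * (v : B))) :
    Function.Injective (fc v) := by
  rw [injective_iff_map_eq_zero]
  intro h hh
  have hspec : ∀ h : C(Circle, ℂ), fc v h = 0 → ∀ z, h (spectrumToCircle v z) = 0 := by
    intro h hh z
    have h0 := (injective_iff_map_eq_zero
      (cfcHom (R := ℂ) (Unitary.coe_isStarNormal v))).mp
      (cfcHom_injective (Unitary.coe_isStarNormal v)) _ hh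
    exact DFunLike.congr_fun h0 z
  have hstep : ∀ k : ℕ, fc v (((translateHom (alpha θ)) : _ → _)^[k] h) = 0 := by
    intro k
    induction k with
    | zero => exact hh
    | succ k ih =>
      rw [Function.iterate_succ_apply', translateHom_apply]
      have h1 := fc_mul_unitary huv (((translateHom (alpha θ)) : _ → _)^[k] h)
      rw [ih, zero_mul] at h1
      calc _ = (star u : B) * ((u : B) * fc v (translate (alpha θ)
            (((translateHom (alpha θ)) : _ → _)^[k] h))) := by
              rw [← mul_assoc, Unitary.coe_star_mul_self, one_mul]
        _ = 0 := by rw [h1, mul_zero]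
  have hiter : ∀ (k : ℕ) (z : Circle),
      (((translateHom (alpha θ)) : _ → _)^[k] h) z = h (alpha θ ^ k * z) := by
    intro k
    induction k with
    | zero => intro z; simp
    | succ k ih =>
      intro z
      rw [Function.iterate_succ_apply', translateHom_apply]
      change (((translateHom (alpha θ)) : _ → _)^[k] h) (alpha θ * z) = _
      rw [ih, ← mul_assoc, ← pow_succ]
  obtain ⟨z₀, hz₀⟩ := spectrum.nonempty (v : B)
  have hzero : (fun z => h (z * spectrumToCircle v ⟨z₀, hz₀⟩)) = fun _ => 0 :=
    (denseRange_alpha_pow hθ).equalizer (by fun_prop) (by fun_prop) (funext fun k => by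
      rw [Function.comp_apply, ← hiter k]
      exact hspec _ (hstep k) _)
  ext z
  simpa using congrFun hzero (z / spectrumToCircle v ⟨z₀, hz₀⟩)

/-- Functions of the power `v ^ n`. -/
theorem fc_pow (v : unitary B) (n : ℕ) (h : C(Circle, ℂ)) :
    fc (v ^ n) h = fc v (h.comp ⟨fun z => z ^ n, by fun_prop⟩) := by
  have : fc (v ^ n) = (fc v).comp
      (ContinuousMap.compStarAlgHom' ℂ ℂ (⟨fun z => z ^ n, by fun_prop⟩ : C(Circle, Circle))) := by
    apply starAlgHom_ext_coeC
    have : (ContinuousMap.compStarAlgHom' ℂ ℂ (⟨fun z => z ^ n, by fun_prop⟩ : C(Circle, Circle)))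
        coeC = coeC ^ n := by
      ext z
      simp
    rw [StarAlgHom.comp_apply, this, map_pow, fc_coeC, fc_coeC, SubmonoidClass.coe_pow]
  rw [this]
  rfl

end

/-! ### Consequences of the relations -/

section

variable {B : Type*} [CStarAlgebra B] {θ : ℝ} {γ : C(Circle, ℝ)} {x : B} {w : unitary B}

theorem Relations.mul_fc (hR : Relations θ γ x w) (h : C(Circle, ℂ)) :
    x * fc w h = fc w (translate (alpha θ)⁻¹ h) * x := by
  refine intertwine (φ := fc w) (ψ := (fc w).comp (translateHom (alpha θ)⁻¹)) ?_ h
  have : translate (alpha θ)⁻¹ coeC = (((alpha θ)⁻¹ : Circle) : ℂ) • coeC := by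
    ext z
    simp [translate]
  rw [StarAlgHom.comp_apply, translateHom_apply, this, map_smul, fc_coeC, hR.comm, smul_mul_assoc]

theorem translate_inv_translate (ζ : Circle) (h : C(Circle, ℂ)) :
    translate ζ⁻¹ (translate ζ h) = h := by
  ext z
  simp [translate]

theorem Relations.fc_mul (hR : Relations θ γ x w) (h : C(Circle, ℂ)) :
    fc w h * x = x * fc w (translate (alpha θ) h) := by
  rw [hR.mul_fc, translate_inv_translate]

theorem Relations.star_mul_fc (hR : Relations θ γ x w) (h : C(Circle, ℂ)) :
    star x * fc w h = fc w (translate (alpha θ) h) * star x := by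
  have := congrArg star (hR.fc_mul (star h))
  have hstar : star (translate (alpha θ) (star h)) = translate (alpha θ) h := by
    ext z
    simp [translate]
  rwa [StarMul.star_mul, StarMul.star_mul, ← map_star, ← map_star, star_star, hstar] at this

/-- The pair `u f(v)`, `v` satisfies the relations of `A_{θ,|f|²}`. -/
theorem relations_unitary_mul_fc {u v : unitary B}
    (huv : (v : B) * (u : B) = (alpha θ : ℂ) • ((u : B) * (v : B))) (f : C(Circle, ℂ)) :
    Relations θ (absSq f) ((u : B) * fc v f) v := by
  have hsq : star f * f = toC (absSq f) := by
    ext z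
    simp [toC, absSq, ← Complex.normSq_eq_norm_sq, Complex.normSq_eq_conj_mul_self]
  refine ⟨?_, ?_, ?_⟩
  · rw [star_mul, mul_assoc, ← mul_assoc (star (u : B)), Unitary.coe_star_mul_self, one_mul,
      ← map_star, ← map_mul, hsq]
  · have h1 := fc_mul_unitary huv (translate (alpha θ)⁻¹ (toC (absSq f)))
    have h2 : translate (alpha θ) (translate (alpha θ)⁻¹ (toC (absSq f))) = toC (absSq f) := by
      simpa using translate_inv_translate (alpha θ)⁻¹ (toC (absSq f))
    rw [h2] at h1
    rw [star_mul, mul_assoc, ← mul_assoc (fc v f), ← map_star, ← map_mul, mul_comm f, hsq,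
      ← mul_assoc, h1, mul_assoc, ← Unitary.coe_star, Unitary.coe_mul_star_self, mul_one]
  · have h1 : fc v f * (v : B) = v * fc v f := by
      rw [← fc_coeC v, ← map_mul, ← map_mul, mul_comm]
    rw [mul_assoc, h1, ← mul_assoc, ← mul_assoc, huv, smul_mul_assoc, smul_smul, ← Circle.coe_mul,
      inv_mul_cancel, Circle.coe_one, one_smul]

/-- If `γ(z) = κ(zⁿ)`, a pair `(x, w)` for `(θ, γ)` gives the pair `(x, wⁿ)` for `(nθ, κ)`. -/
theorem Relations.pow (hR : Relations θ γ x w) (n : ℕ) {κ : C(Circle, ℝ)}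
    (hκ : ∀ z, γ z = κ (z ^ n)) : Relations (n * θ) κ x (w ^ n) := by
  refine ⟨?_, ?_, ?_⟩
  · rw [hR.star_mul, fc_pow]
    congr 1
    ext z
    simp [toC, hκ]
  · rw [hR.mul_star, fc_pow]
    congr 1
    ext z
    simp [toC, translate, hκ, alpha_natCast_mul, mul_pow]
  · have h : ∀ m : ℕ, x * (w : B) ^ m =
        ((((alpha θ)⁻¹ ^ m : Circle)) : ℂ) • ((w : B) ^ m * x) := by
      intro m
      induction m with
      | zero => simp
      | succ m ih =>
        rw [pow_succ, ← mul_assoc, ih, smul_mul_assoc, mul_assoc, hR.comm, mul_smul_comm,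
          smul_smul, ← Circle.coe_mul, ← pow_succ, ← mul_assoc]
    rw [SubmonoidClass.coe_pow, h, alpha_natCast_mul, inv_pow]

end

end RotAlg

namespace RotAlg

/-! ### Cesàro means of an automorphism -/

section Cesaro

open Filter Topology Finset

variable {C : Type*} [CStarAlgebra C]

/-- The average of `t, σ(t), …, σᴺ⁻¹(t)`. It is `0` for `N = 0`. -/
noncomputable def cesaro (σ : C ≃⋆ₐ[ℂ] C) (N : ℕ) (t : C) : C :=
  (N : ℂ)⁻¹ • ∑ k ∈ range N, (σ ^ k) t

theorem norm_starAlgEquiv_apply (σ : C ≃⋆ₐ[ℂ] C) (t : C) : ‖σ t‖ = ‖t‖ :=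
  NonUnitalStarAlgHom.norm_map σ σ.injective t

theorem cesaro_add (σ : C ≃⋆ₐ[ℂ] C) (N : ℕ) (s t : C) :
    cesaro σ N (s + t) = cesaro σ N s + cesaro σ N t := by
  simp only [cesaro, map_add, sum_add_distrib, smul_add]

theorem cesaro_smul (σ : C ≃⋆ₐ[ℂ] C) (N : ℕ) (c : ℂ) (t : C) :
    cesaro σ N (c • t) = c • cesaro σ N t := by
  simp only [cesaro, map_smul, ← smul_sum, smul_comm c]

theorem norm_cesaro_le (σ : C ≃⋆ₐ[ℂ] C) (N : ℕ) (t : C) : ‖cesaro σ N t‖ ≤ ‖t‖ := by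
  rcases Nat.eq_zero_or_pos N with rfl | hN
  · simp [cesaro]
  · have h : ‖∑ k ∈ range N, (σ ^ k) t‖ ≤ N * ‖t‖ := by
      refine (norm_sum_le _ _).trans ?_
      simp only [norm_starAlgEquiv_apply, sum_const, card_range, nsmul_eq_mul, le_refl]
    rw [cesaro, norm_smul, norm_inv, Complex.norm_natCast, inv_mul_le_iff₀ (by positivity)]
    exact h

theorem zpow_apply_of_apply_eq_smul {σ : C ≃⋆ₐ[ℂ] C} {t : C} {c : Circle}
    (h : σ t = (c : ℂ) • t) (k : ℤ) : (σ ^ k) t = ((c ^ k : Circle) : ℂ) • t := by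
  have hinv : σ⁻¹ t = ((c⁻¹ : Circle) : ℂ) • t := by
    have h1 : σ⁻¹ (σ t) = t := by
      rw [← StarAlgEquiv.mul_apply, inv_mul_cancel, StarAlgEquiv.one_apply]
    rw [h, map_smul] at h1
    nth_rw 2 [← h1]
    rw [smul_smul, ← Circle.coe_mul, inv_mul_cancel, Circle.coe_one, one_smul]
  induction k with
  | zero => simp
  | succ k ih =>
    rw [zpow_add_one, StarAlgEquiv.mul_apply, h, map_smul, ih, smul_smul, ← Circle.coe_mul,
      mul_comm, ← zpow_add_one]
  | pred k ih =>
    rw [zpow_sub_one, StarAlgEquiv.mul_apply, hinv, map_smul, ih, smul_smul, ← Circle.coe_mul,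
      mul_comm, ← zpow_sub_one]

theorem pow_apply_of_apply_eq_smul {σ : C ≃⋆ₐ[ℂ] C} {t : C} {c : Circle}
    (h : σ t = (c : ℂ) • t) (k : ℕ) : (σ ^ k) t = ((c : ℂ) ^ k) • t := by
  simpa using zpow_apply_of_apply_eq_smul h k

theorem cesaro_of_apply_eq {σ : C ≃⋆ₐ[ℂ] C} {t : C} (h : σ t = t) {N : ℕ} (hN : N ≠ 0) :
    cesaro σ N t = t := by
  have h1 : ∀ k : ℕ, (σ ^ k) t = t := fun k => by
    simpa using pow_apply_of_apply_eq_smul (σ := σ) (t := t) (c := 1) (by simpa using h) k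
  have hN' : (N : ℂ) ≠ 0 := by exact_mod_cast hN
  simp only [cesaro, h1, sum_const, card_range]
  rw [← Nat.cast_smul_eq_nsmul ℂ, smul_smul, inv_mul_cancel₀ hN', one_smul]

/-- The means of an eigenvector with eigenvalue `c ≠ 1` tend to zero: the geometric
sums of `c` are bounded. -/
theorem tendsto_cesaro_zero {σ : C ≃⋆ₐ[ℂ] C} {t : C} {c : Circle} (hc : c ≠ 1)
    (h : σ t = (c : ℂ) • t) : Tendsto (fun N => cesaro σ N t) atTop (𝓝 0) := by
  have hc' : (c : ℂ) ≠ 1 := fun h => hc (Circle.ext (by simpa using h))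
  have hbound : ∀ N : ℕ, ‖cesaro σ N t‖ ≤ (N : ℝ)⁻¹ * (2 / ‖(c : ℂ) - 1‖ * ‖t‖) := by
    intro N
    simp only [cesaro, pow_apply_of_apply_eq_smul h, ← sum_smul]
    rw [geom_sum_eq hc', norm_smul, norm_smul, norm_inv, Complex.norm_natCast, norm_div]
    gcongr
    refine (norm_sub_le _ _).trans ?_
    simp only [norm_pow, Circle.norm_coe, one_pow, norm_one]
    norm_num
  refine squeeze_zero_norm hbound ?_
  simpa using (tendsto_inv_atTop_nhds_zero_nat (𝕜 := ℝ)).mul_const (2 / ‖(c : ℂ) - 1‖ * ‖t‖)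

/-- If every orbit segment of bounded length returns to within `ε` of `b ≥ 0`, then sums of
translates of the means of `b` dominate `b - ε`, which bounds `b` by its means. -/
theorem norm_le_of_recurrent {σ : C ≃⋆ₐ[ℂ] C} (a : C) {F : Finset ℤ} {N : ℕ} (hN : N ≠ 0)
    {ε : ℝ} (hF : ∀ k : ℕ, ∃ j ∈ F, ‖(σ ^ (j + k)) (star a * a) - star a * a‖ ≤ ε) :
    ‖star a * a‖ ≤ ε + #F * ‖cesaro σ N (star a * a)‖ := by
  let _ := CStarAlgebra.spectralOrder C
  let _ := CStarAlgebra.spectralOrderedRing C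
  set b := star a * a with hb
  have hb0 : 0 ≤ b := star_mul_self_nonneg a
  have hpos : ∀ k : ℤ, 0 ≤ (σ ^ k) b := fun k => by
    rw [hb, map_mul, map_star]
    exact star_mul_self_nonneg _
  have hsa : ∀ k : ℤ, IsSelfAdjoint ((σ ^ k) b) := fun k => (hpos k).isSelfAdjoint
  have hNr : (0 : ℝ) < N := by positivity
  have hε : 0 ≤ ε := by
    obtain ⟨j, -, hj⟩ := hF 0
    exact (norm_nonneg _).trans hj
  have hstep : ∀ k : ℕ, b ≤ algebraMap ℝ C ε + ∑ j ∈ F, (σ ^ (j + k)) b := by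
    intro k
    obtain ⟨j, hj, hjε⟩ := hF k
    have h1 : b - (σ ^ (j + k)) b ≤ algebraMap ℝ C ε := by
      have hs : IsSelfAdjoint (b - (σ ^ (j + k)) b) := hb0.isSelfAdjoint.sub (hsa _)
      refine hs.le_algebraMap_norm_self.trans ?_
      rw [norm_sub_rev] at hjε
      exact algebraMap_mono C hjε
    have h2 : (σ ^ (j + k)) b ≤ ∑ j ∈ F, (σ ^ (j + k)) b :=
      single_le_sum (f := fun j => (σ ^ (j + (k : ℤ))) b) (fun i _ => hpos _) hj
    exact (sub_le_iff_le_add.mp h1).trans (add_le_add_right h2 _)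
  set Z := ∑ k ∈ range N, ∑ j ∈ F, (σ ^ (j + (k : ℤ))) b with hZ
  have hZnorm : ‖Z‖ ≤ N * (#F * ‖cesaro σ N b‖) := by
    have h1 : Z = ∑ j ∈ F, (σ ^ j) ((N : ℂ) • cesaro σ N b) := by
      have hN' : (N : ℂ) ≠ 0 := by exact_mod_cast hN
      rw [hZ, sum_comm]
      refine sum_congr rfl fun j _ => ?_
      rw [cesaro, smul_smul, mul_inv_cancel₀ hN', one_smul, map_sum]
      refine sum_congr rfl fun k _ => ?_
      rw [zpow_add, zpow_natCast, StarAlgEquiv.mul_apply]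
    rw [h1]
    refine (norm_sum_le _ _).trans (le_of_eq ?_)
    simp only [norm_starAlgEquiv_apply, sum_const, norm_smul, Complex.norm_natCast, nsmul_eq_mul]
    ring
  have hsum : (N : ℝ) • b ≤ algebraMap ℝ C (N * ε + N * (#F * ‖cesaro σ N b‖)) := by
    have hZsa : IsSelfAdjoint Z :=
      isSelfAdjoint_sum _ fun k _ => isSelfAdjoint_sum _ fun j _ => hsa _
    calc (N : ℝ) • b = ∑ k ∈ range N, b := by
          rw [sum_const, card_range, Nat.cast_smul_eq_nsmul]
      _ ≤ ∑ k ∈ range N, (algebraMap ℝ C ε + ∑ j ∈ F, (σ ^ (j + (k : ℤ))) b) :=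
          sum_le_sum fun k _ => hstep k
      _ = algebraMap ℝ C (N * ε) + Z := by
          rw [sum_add_distrib, sum_const, card_range, map_mul, map_natCast, nsmul_eq_mul]
      _ ≤ algebraMap ℝ C (N * ε) + algebraMap ℝ C (N * (#F * ‖cesaro σ N b‖)) :=
          add_le_add_right (hZsa.le_algebraMap_norm_self.trans (algebraMap_mono C hZnorm)) _
      _ = _ := by rw [map_add]
  have hnorm := (CStarAlgebra.norm_le_iff_le_algebraMap ((N : ℝ) • b) (by positivity)
    (smul_nonneg hNr.le hb0)).mpr hsum
  rw [norm_smul, Real.norm_natCast, ← mul_add] at hnorm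
  exact le_of_mul_le_mul_left hnorm hNr

end Cesaro

/-! ### Faithful representations -/

section Faithful

open Filter Topology Unitary

variable {C : Type*} [CStarAlgebra C] {θ : ℝ} {γ : C(Circle, ℝ)} {X : C} {W : unitary C}

/-- The elements `h(W) Xⁿ` and `h(W) X*ⁿ`. -/
def monomials (X : C) (W : unitary C) : Set C :=
  {t | ∃ (h : C(Circle, ℂ)) (n : ℕ), t = fc W h * X ^ n ∨ t = fc W h * star X ^ n}

theorem mul_mem_monomials (hR : Relations θ γ X W) {c t : C}
    (hc : c ∈ ({X, (W : C)} ∪ star {X, (W : C)} : Set C)) (ht : t ∈ monomials X W) :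
    c * t ∈ monomials X W := by
  have hW : ∀ k : C(Circle, ℂ), fc W k * t ∈ monomials X W := by
    intro k
    obtain ⟨h, n, rfl | rfl⟩ := ht
    · exact ⟨k * h, n, Or.inl (by rw [map_mul, mul_assoc])⟩
    · exact ⟨k * h, n, Or.inr (by rw [map_mul, mul_assoc])⟩
  rcases hc with (rfl | rfl) | hc
  · obtain ⟨h, n, rfl | rfl⟩ := ht
    · exact ⟨_, n + 1, Or.inl (by rw [← mul_assoc, hR.mul_fc, mul_assoc, ← pow_succ'])⟩
    · cases n with
      | zero => exact ⟨_, 1, Or.inl (by rw [← mul_assoc, hR.mul_fc, pow_zero, mul_one, pow_one])⟩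
      | succ n =>
        refine ⟨translate (alpha θ)⁻¹ h * translate (alpha θ)⁻¹ (toC γ), n, Or.inr ?_⟩
        rw [← mul_assoc, hR.mul_fc, pow_succ', mul_assoc, ← mul_assoc c, hR.mul_star,
          map_mul, mul_assoc]
  · rw [← fc_coeC W]
    exact hW _
  · rw [Set.mem_star] at hc
    rcases hc with hc | hc
    · obtain rfl : c = star X := by rw [← hc, star_star]
      obtain ⟨h, n, rfl | rfl⟩ := ht
      · cases n with
        | zero =>
          exact ⟨_, 1, Or.inr (by rw [← mul_assoc, hR.star_mul_fc, pow_zero, mul_one, pow_one])⟩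
        | succ n =>
          refine ⟨translate (alpha θ) h * toC γ, n, Or.inl ?_⟩
          rw [← mul_assoc, hR.star_mul_fc, pow_succ', mul_assoc, ← mul_assoc (star X), hR.star_mul,
            map_mul, mul_assoc]
      · exact ⟨_, n + 1, Or.inr (by rw [← mul_assoc, hR.star_mul_fc, mul_assoc, ← pow_succ'])⟩
    · obtain rfl : c = star (W : C) := by rw [← show star c = (W : C) from hc, star_star]
      rw [← fc_coeC W, ← map_star]
      exact hW _

theorem adjoin_le_span_monomials (hR : Relations θ γ X W) {p : C}
    (hp : p ∈ StarAlgebra.adjoin ℂ {X, (W : C)}) : p ∈ Submodule.span ℂ (monomials X W) := by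
  have h1 : p ∈ Subalgebra.toSubmodule (StarAlgebra.adjoin ℂ {X, (W : C)}).toSubalgebra := hp
  rw [StarAlgebra.adjoin_eq_span] at h1
  refine Submodule.span_mono ?_ h1
  intro t ht
  induction ht using Submonoid.closure_induction_left with
  | one => exact ⟨1, 0, Or.inl (by simp)⟩
  | mul_left c hc t _ ih => exact mul_mem_monomials hR hc ih

/-- Monomials are eigenvectors of conjugation by `W`, and those with eigenvalue `1` are
functions of `W`. -/
theorem conj_monomial (hR : Relations θ γ X W) {t : C} (ht : t ∈ monomials X W) :
    ∃ m : ℤ, conjStarAlgAut ℂ C W t = ((alpha θ ^ m : Circle) : ℂ) • t ∧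
      (m = 0 → ∃ h, t = fc W h) := by
  have hfc : ∀ h, conjStarAlgAut ℂ C W (fc W h) = fc W h := fun h => by
    have h1 : (W : C) * fc W h = fc W h * W := by rw [← fc_coeC W, ← map_mul, ← map_mul, mul_comm]
    rw [conjStarAlgAut_apply, h1, mul_assoc, ← coe_star, coe_mul_star_self, mul_one]
  have hX : conjStarAlgAut ℂ C W X = (alpha θ : ℂ) • X := by
    have h1 : (W : C) * X = (alpha θ : ℂ) • (X * W) := by
      rw [hR.comm, smul_smul, ← Circle.coe_mul, mul_inv_cancel, Circle.coe_one, one_smul]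
    rw [conjStarAlgAut_apply, h1, smul_mul_assoc, mul_assoc, ← coe_star, coe_mul_star_self, mul_one]
  have hX' : conjStarAlgAut ℂ C W (star X) = (((alpha θ)⁻¹ : Circle) : ℂ) • star X := by
    rw [map_star, hX, star_smul, Circle.coe_inv_eq_conj]
    rfl
  obtain ⟨h, n, rfl | rfl⟩ := ht
  · refine ⟨n, ?_, fun hn => ⟨h, ?_⟩⟩
    · rw [map_mul, map_pow, hfc, hX, smul_pow, mul_smul_comm, zpow_natCast, Circle.coe_pow]
    · obtain rfl : n = 0 := by exact_mod_cast hn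
      simp
  · refine ⟨-n, ?_, fun hn => ⟨h, ?_⟩⟩
    · rw [map_mul, map_pow, hfc, hX', smul_pow, mul_smul_comm, zpow_neg, zpow_natCast,
        ← Circle.coe_pow, inv_pow]
    · obtain rfl : n = 0 := by simpa using hn
      simp

/-- On the `*`-algebra generated by `X` and `W`, the means of conjugation by `W` converge to a
function of `W`. -/
theorem exists_tendsto_cesaro (hθ : Irrational θ) (hR : Relations θ γ X W) {p : C}
    (hp : p ∈ Submodule.span ℂ (monomials X W)) :
    ∃ h, Tendsto (fun N => cesaro (conjStarAlgAut ℂ C W) N p) atTop (𝓝 (fc W h)) := by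
  induction hp using Submodule.span_induction with
  | mem t ht =>
    obtain ⟨m, hm, h0⟩ := conj_monomial hR ht
    by_cases hm0 : m = 0
    · obtain ⟨h, rfl⟩ := h0 hm0
      refine ⟨h, tendsto_const_nhds.congr' ?_⟩
      filter_upwards [eventually_ne_atTop 0] with N hN
      exact (cesaro_of_apply_eq (by simpa [hm0] using hm) hN).symm
    · exact ⟨0, by simpa using tendsto_cesaro_zero (alpha_zpow_ne_one hθ hm0) hm⟩
  | zero => exact ⟨0, by simp [cesaro]⟩
  | add s t _ _ hs ht =>
    obtain ⟨h, hh⟩ := hs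
    obtain ⟨k, hk⟩ := ht
    exact ⟨h + k, by simpa only [cesaro_add, map_add] using hh.add hk⟩
  | smul c t _ ht =>
    obtain ⟨h, hh⟩ := ht
    exact ⟨c • h, by simpa only [cesaro_smul, map_smul] using hh.const_smul c⟩

/-- On the `*`-algebra generated by `X` and `W`, conjugation by `Wᵏ` is close to the identity
when `αᵏ` is close to `1`. -/
theorem tendsto_conj_zpow (hR : Relations θ γ X W) {p : C}
    (hp : p ∈ Submodule.span ℂ (monomials X W)) :
    Tendsto (fun k : ℤ => (conjStarAlgAut ℂ C W ^ k) p)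
      (comap (fun k : ℤ => alpha θ ^ k) (𝓝 1)) (𝓝 p) := by
  induction hp using Submodule.span_induction with
  | mem t ht =>
    obtain ⟨m, hm, -⟩ := conj_monomial hR ht
    simp only [zpow_apply_of_apply_eq_smul hm, ← zpow_mul, mul_comm m]
    simp only [zpow_mul]
    have hcont : Continuous fun z : Circle => ((z ^ m : Circle) : ℂ) • t :=
      (coeC.continuous.comp (continuous_zpow m)).smul continuous_const
    have h1 := (hcont.tendsto 1).comp
      (tendsto_comap (f := fun k : ℤ => alpha θ ^ k) (x := 𝓝 1))
    simpa [Function.comp_def] using h1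
  | zero => simpa only [map_zero] using tendsto_const_nhds
  | add s t _ _ hs ht => simpa only [map_add] using hs.add ht
  | smul c t _ ht => simpa only [map_smul] using ht.const_smul c

/-- The conditional expectation given by the means of conjugation by `W` is faithful:
by recurrence of the rotation, `a* a` is bounded by its means. -/
theorem eq_zero_of_tendsto_cesaro (hθ : Irrational θ) (hR : Relations θ γ X W)
    (hd : Dense (StarAlgebra.adjoin ℂ {X, (W : C)} : Set C)) {a : C}
    (ha : Tendsto (fun N => cesaro (conjStarAlgAut ℂ C W) N (star a * a)) atTop (𝓝 0)) :
    a = 0 := by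
  rw [← CStarRing.star_mul_self_eq_zero_iff, ← norm_le_zero_iff]
  set b := star a * a
  refine le_of_forall_pos_le_add fun ε hε => ?_
  rw [zero_add]
  obtain ⟨p, hp, hbp⟩ := hd.exists_dist_lt b (show 0 < ε / 3 by positivity)
  have hnear := (tendsto_conj_zpow hR (adjoin_le_span_monomials hR hp)).eventually
    (Metric.ball_mem_nhds p (show 0 < ε / 3 by positivity))
  rw [eventually_comap, _root_.eventually_nhds_iff] at hnear
  obtain ⟨U, hU, hUo, h1⟩ := hnear
  obtain ⟨F, hF⟩ := exists_finset_alpha_zpow_mul_mem hθ hUo h1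
  have hrec : ∀ k : ℕ, ∃ j ∈ F, ‖(conjStarAlgAut ℂ C W ^ (j + (k : ℤ))) b - b‖ ≤ ε := by
    intro k
    obtain ⟨j, hj, hjU⟩ := hF (alpha θ ^ (k : ℤ))
    rw [← zpow_add] at hjU
    refine ⟨j, hj, ?_⟩
    have h2 := hU _ hjU _ rfl
    rw [dist_eq_norm] at h2 hbp
    have h3 : (conjStarAlgAut ℂ C W ^ (j + (k : ℤ))) b - b =
        (conjStarAlgAut ℂ C W ^ (j + (k : ℤ))) (b - p) +
          ((conjStarAlgAut ℂ C W ^ (j + (k : ℤ))) p - p) - (b - p) := by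
      rw [map_sub]
      abel
    rw [h3]
    refine (norm_sub_le _ _).trans ((add_le_add_left (norm_add_le _ _) _).trans ?_)
    rw [norm_starAlgEquiv_apply]
    linarith
  have hlim : Tendsto (fun N => ε + F.card * ‖cesaro (conjStarAlgAut ℂ C W) N b‖) atTop
      (𝓝 (ε + F.card * ‖(0 : C)‖)) := (ha.norm.const_mul _).const_add _
  rw [norm_zero, mul_zero, add_zero] at hlim
  refine ge_of_tendsto hlim ?_
  filter_upwards [eventually_ne_atTop 0] with N hN
  exact norm_le_of_recurrent a hN hrec

/-- A representation of the C*-algebra generated by a pair `(X, W)` that satisfies the relations is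
faithful if it is faithful on the functions of `W`. -/
theorem injective_of_injective_fc {B : Type*} [CStarAlgebra B] (hθ : Irrational θ)
    (hR : Relations θ γ X W) (hd : Dense (StarAlgebra.adjoin ℂ {X, (W : C)} : Set C))
    (π : C →⋆ₐ[ℂ] B) {w : unitary B} (hw : π W = w) (hinj : Function.Injective (fc w)) :
    Function.Injective π := by
  rw [injective_iff_map_eq_zero]
  intro a ha
  refine eq_zero_of_tendsto_cesaro hθ hR hd (Metric.tendsto_atTop.mpr fun ε hε => ?_)
  set b := star a * a
  have hb : π b = 0 := by rw [map_mul, ha, mul_zero]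
  obtain ⟨p, hp, hbp⟩ := hd.exists_dist_lt b (show 0 < ε / 3 by positivity)
  rw [dist_eq_norm] at hbp
  obtain ⟨h, hh⟩ := exists_tendsto_cesaro hθ hR (adjoin_le_span_monomials hR hp)
  have hπ : Continuous π := continuous_starAlgHom π
  -- The limit of the means of `p` is small, since its image in `B` is.
  have hcomm : ∀ N, π (cesaro (conjStarAlgAut ℂ C W) N p) =
      cesaro (conjStarAlgAut ℂ B w) N (π p) := by
    intro N
    simp only [cesaro, map_smul, map_sum]
    congr 1
    refine Finset.sum_congr rfl fun k _ => ?_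
    rw [← map_pow, ← map_pow, conjStarAlgAut_apply, conjStarAlgAut_apply, map_mul, map_mul, map_star,
      SubmonoidClass.coe_pow, SubmonoidClass.coe_pow, map_pow, hw]
  have hπp : ‖π p‖ ≤ ε / 3 := by
    have h1 : π p = - π (b - p) := by rw [map_sub, hb, zero_sub, neg_neg]
    rw [h1, norm_neg]
    exact (NonUnitalStarAlgHom.norm_apply_le π _).trans hbp.le
  have hsmall : ‖fc W h‖ ≤ ε / 3 := by
    have h1 : Tendsto (fun N => π (cesaro (conjStarAlgAut ℂ C W) N p)) atTop (𝓝 (fc w h)) := by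
      rw [← map_fc π W w hw]
      exact (hπ.tendsto _).comp hh
    have h2 : ‖fc w h‖ ≤ ε / 3 := le_of_tendsto h1.norm (Eventually.of_forall fun N => by
      rw [hcomm]
      exact (norm_cesaro_le _ _ _).trans hπp)
    rw [NonUnitalStarAlgHom.norm_map (fc w) hinj] at h2
    exact (NonUnitalStarAlgHom.norm_apply_le (fc W) h).trans h2
  obtain ⟨N₀, hN₀⟩ := Metric.tendsto_atTop.mp hh (ε / 3) (by positivity)
  refine ⟨N₀, fun N hN => ?_⟩
  have h4 := hN₀ N hN
  rw [dist_eq_norm] at h4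
  have h5 : cesaro (conjStarAlgAut ℂ C W) N b = cesaro (conjStarAlgAut ℂ C W) N (b - p) +
      ((cesaro (conjStarAlgAut ℂ C W) N p - fc W h) + fc W h) := by
    rw [sub_add_cancel, ← cesaro_add, sub_add_cancel]
  rw [dist_zero_right, h5]
  have h6 := norm_cesaro_le (conjStarAlgAut ℂ C W) N (b - p)
  have h7 := norm_add_le (cesaro (conjStarAlgAut ℂ C W) N (b - p))
    ((cesaro (conjStarAlgAut ℂ C W) N p - fc W h) + fc W h)
  have h8 := norm_add_le (cesaro (conjStarAlgAut ℂ C W) N p - fc W h) (fc W h)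
  linarith

end Faithful

end RotAlg

namespace RotAlg

/-! ### Recovering the unitary from the generator -/

section Separation

variable {B : Type*} [CStarAlgebra B] {θ : ℝ} {γ : C(Circle, ℝ)} {x : B} {w : unitary B}

/-- Suppose that every orbit of the rotation meets the zero set of `γ` at most once and that `γ`
has no nontrivial period. Then the functions `h` with `h(w)` in the C*-algebra of `x` separate
points: if `z₁` and `z₂` are not separated, then on a half-orbit that avoids the zeros of `γ`
no two corresponding points are, and `z₂ / z₁` is a period of `γ`. -/
theorem fc_mem_elemental (hθ : Irrational θ) (hR : Relations θ γ x w)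
    (hY : ∀ z, γ z = 0 → ∀ k : ℤ, k ≠ 0 → γ (alpha θ ^ k * z) ≠ 0)
    (hper : ¬ Periodic γ) (h : C(Circle, ℂ)) : fc w h ∈ StarAlgebra.elemental ℂ x := by
  set A := StarAlgebra.elemental ℂ x
  have hx : x ∈ A := StarAlgebra.elemental.self_mem ℂ x
  have hx' : star x ∈ A := StarAlgebra.elemental.star_self_mem ℂ x
  let S : StarSubalgebra ℂ C(Circle, ℂ) := A.comap (fc w)
  have hS : IsClosed (S : Set C(Circle, ℂ)) :=
    (StarAlgebra.elemental.isClosed ℂ x).preimage (continuous_starAlgHom (fc w))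
  have hγ : toC γ ∈ S := by
    change fc w (toC γ) ∈ A
    rw [← hR.star_mul]
    exact mul_mem hx' hx
  have hfwd : ∀ k ∈ S, toC γ * translate (alpha θ) k ∈ S := fun k hk => by
    change fc w _ ∈ A
    rw [map_mul, ← hR.star_mul, mul_assoc, ← hR.fc_mul]
    exact mul_mem hx' (mul_mem hk hx)
  have hbwd : ∀ k ∈ S, translate (alpha θ)⁻¹ k * translate (alpha θ)⁻¹ (toC γ) ∈ S := fun k hk => by
    change fc w _ ∈ A
    rw [map_mul, ← hR.mul_star, ← mul_assoc, ← hR.mul_fc]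
    exact mul_mem (mul_mem hx hk) hx'
  have hbwd' : translate (alpha θ)⁻¹ (toC γ) ∈ S := by
    change fc w _ ∈ A
    rw [← hR.mul_star]
    exact mul_mem hx hx'
  have htop : S = ⊤ := by
    refine eq_top_of_isClosed_of_separatesPoints hS fun z₁ z₂ H => ?_
    have hγeq : ∀ {y₁ y₂ : Circle}, (∀ k ∈ S, k y₁ = k y₂) → γ y₁ = γ y₂ := fun Hy => by
      simpa [toC] using Hy _ hγ
    have hquot : IsPeriod γ (z₂ / z₁) := by
      by_cases hzero : ∃ m : ℕ, γ (alpha θ ^ m * z₁) = 0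
      · obtain ⟨m, hm⟩ := hzero
        have hne : ∀ k : ℕ, γ ((alpha θ)⁻¹ * ((alpha θ)⁻¹ ^ k * z₁)) ≠ 0 := fun k => by
          have h1 := hY _ hm (-(k + 1 + m)) (by omega)
          convert h1 using 2
          rw [← mul_assoc, ← mul_assoc, ← pow_succ', ← zpow_natCast (alpha θ) m, ← zpow_add,
            inv_pow, ← zpow_natCast, ← zpow_neg]
          congr 2
          push_cast
          ring
        refine isPeriod_of_forall_pow γ.continuous (denseRange_alpha_inv_pow hθ) fun k => ?_
        refine hγeq ?_
        induction k with
        | zero => simpa using H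
        | succ k ih =>
          intro p hp
          have h1 := ih _ (hbwd p hp)
          have h2 := ih _ hbwd'
          have h3 : (translate (alpha θ)⁻¹ (toC γ)) ((alpha θ)⁻¹ ^ k * z₁) ≠ 0 := by
            simpa [translate, toC] using hne k
          rw [ContinuousMap.mul_apply, ContinuousMap.mul_apply, ← h2] at h1
          rw [pow_succ', mul_assoc, mul_assoc]
          exact mul_right_cancel₀ h3 h1
      · push Not at hzero
        refine isPeriod_of_forall_pow γ.continuous (denseRange_alpha_pow hθ) fun k => ?_
        refine hγeq ?_
        induction k with
        | zero => simpa using H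
        | succ k ih =>
          intro p hp
          have h1 := ih _ (hfwd p hp)
          have h2 := ih _ hγ
          have h3 : toC γ (alpha θ ^ k * z₁) ≠ 0 := by simpa [toC] using hzero k
          rw [ContinuousMap.mul_apply, ContinuousMap.mul_apply, ← h2] at h1
          rw [pow_succ', mul_assoc, mul_assoc]
          exact mul_left_cancel₀ h3 h1
    by_contra hne
    exact hper ⟨z₂ / z₁, fun h1 => hne (div_eq_one.mp h1).symm, hquot⟩
  have : h ∈ S := htop ▸ StarSubalgebra.mem_top
  exact this

end Separation

/-! ### The isomorphism with the universal algebra -/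

theorem dense_adjoin_gen (θ : ℝ) (γ : C(Circle, ℝ)) :
    Dense (StarAlgebra.adjoin ℂ {genX.{u} θ γ, (genW.{u} θ γ : GenRotAlg.{u} θ γ)} :
      Set (GenRotAlg.{u} θ γ)) := by
  intro a
  rw [closure_subtype]
  have h1 : (Subtype.val '' (StarAlgebra.adjoin ℂ
      {genX.{u} θ γ, (genW.{u} θ γ : GenRotAlg.{u} θ γ)} : Set (GenRotAlg.{u} θ γ))) =
      (StarAlgebra.adjoin ℂ {bigX.{u} θ γ, bigW.{u} θ γ} : Set (Big.{u} θ γ)) := by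
    have h2 := StarAlgHom.map_adjoin (GenRotAlg.{u} θ γ).subtype
      {genX.{u} θ γ, (genW.{u} θ γ : GenRotAlg.{u} θ γ)}
    rw [Set.image_pair] at h2
    exact congrArg (fun S : StarSubalgebra ℂ (Big.{u} θ γ) => (S : Set (Big.{u} θ γ))) h2
  rw [h1]
  exact a.2

/-- The C*-algebra of `x` is `A_{θ,γ}` if `w` has full spectrum, the orbits meet the zero set of `γ`
at most once, and `γ` has no nontrivial period. -/
theorem nonempty_elemental_equiv {B : Type u} [CStarAlgebra B] {θ : ℝ} (hθ : Irrational θ)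
    {γ : C(Circle, ℝ)} {x : B} {w : unitary B} (hR : Relations θ γ x w)
    (hinj : Function.Injective (fc w))
    (hY : ∀ z, γ z = 0 → ∀ k : ℤ, k ≠ 0 → γ (alpha θ ^ k * z) ≠ 0) (hper : ¬ Periodic γ) :
    Nonempty (StarAlgebra.elemental ℂ x ≃⋆ₐ[ℂ] GenRotAlg.{u} θ γ) := by
  obtain ⟨φ, ⟨hφx, hφw⟩, -⟩ := existsUnique_lift θ γ x w hR
  have hφ : Function.Injective φ :=
    injective_of_injective_fc hθ (relations_gen θ γ) (dense_adjoin_gen θ γ) φ hφw hinj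
  have hcont := continuous_starAlgHom φ
  have hrange : φ.range = StarAlgebra.elemental ℂ x := by
    apply le_antisymm
    · rintro _ ⟨a, rfl⟩
      have hcl : IsClosed {a | φ a ∈ StarAlgebra.elemental ℂ x} :=
        (StarAlgebra.elemental.isClosed ℂ x).preimage hcont
      have hsub : StarAlgebra.adjoin ℂ {genX.{u} θ γ, (genW.{u} θ γ : GenRotAlg.{u} θ γ)} ≤
          (StarAlgebra.elemental ℂ x).comap φ := by
        refine StarAlgebra.adjoin_le ?_
        rintro _ (rfl | rfl)
        · rw [SetLike.mem_coe, StarSubalgebra.mem_comap, hφx]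
          exact StarAlgebra.elemental.self_mem ℂ x
        · rw [SetLike.mem_coe, StarSubalgebra.mem_comap, hφw, ← fc_coeC]
          exact fc_mem_elemental hθ hR hY hper _
      exact closure_minimal hsub hcl (dense_adjoin_gen θ γ a)
    · refine StarAlgebra.elemental.le_of_mem ?_ ⟨_, hφx⟩
      exact (NonUnitalStarAlgHom.isometry φ hφ).isClosedEmbedding.isClosed_range
  exact ⟨hrange ▸ (StarAlgEquiv.ofInjective φ hφ).symm⟩

/-! ### The zero set and the periods of `|f|` -/

/-- Each of the three conditions on the zero set `Y` says that no point of `Y` returns to `Y`. -/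
theorem notMem_of_orbit_condition {θ : ℝ} (hθ : Irrational θ) {Y : Set Circle}
    (hφ : (∀ n : ℤ, n ≠ 0 → rot θ n Y ∩ Y = ∅) ∨
      (∀ ξ : Circle, (orb θ ξ ∩ Y).Subsingleton) ∨
      (⋃ n : ℕ, rot θ n Y) ∩ (⋃ k : ℕ, rot θ (-((k : ℤ) + 1)) Y) = ∅)
    {z : Circle} (hz : z ∈ Y) {k : ℤ} (hk : k ≠ 0) : alpha θ ^ k * z ∉ Y := by
  intro hz'
  have hnot : ∀ {s : Set Circle} {y : Circle}, s = ∅ → y ∉ s := fun h => h ▸ Set.notMem_empty _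
  rcases hφ with h | h | h
  · exact hnot (h k hk) ⟨⟨z, hz, rfl⟩, hz'⟩
  · have h1 : alpha θ ^ k * z = z := h z ⟨⟨k, rfl⟩, hz'⟩ ⟨⟨0, by simp⟩, hz⟩
    exact alpha_zpow_ne_one hθ hk (mul_eq_right.mp h1)
  · rcases lt_or_gt_of_ne hk with hk' | hk'
    · refine hnot h (y := alpha θ ^ k * z) ⟨Set.mem_iUnion.mpr ⟨0, _, hz', by simp⟩,
        Set.mem_iUnion.mpr ⟨(-k - 1).toNat, z, hz, ?_⟩⟩
      have : -(((-k - 1).toNat : ℤ) + 1) = k := by omega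
      rw [this]
    · refine hnot h (y := z) ⟨Set.mem_iUnion.mpr ⟨0, z, hz, by simp⟩,
        Set.mem_iUnion.mpr ⟨(k - 1).toNat, _, hz', ?_⟩⟩
      have : -(((k - 1).toNat : ℤ) + 1) = -k := by omega
      rw [this]
      simp

theorem absSq_eq_zero_iff {f : C(Circle, ℂ)} {z : Circle} : absSq f z = 0 ↔ f z = 0 := by
  simp [absSq]

theorem isPeriod_sq_iff {h : Circle → ℝ} (hh : ∀ z, 0 ≤ h z) (ζ : Circle) :
    IsPeriod (fun z => h z ^ 2) ζ ↔ IsPeriod h ζ :=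
  forall_congr' fun _ => sq_eq_sq₀ (hh _) (hh _)

theorem circle_pow_surjective {n : ℕ} (hn : n ≠ 0) :
    Function.Surjective (fun z : Circle => z ^ n) :=
  have : NeZero n := ⟨hn⟩
  (Circle.isQuotientCoveringMap_npow n).toIsQuotientMap.surjective

end RotAlg

open RotAlg in
theorem mainTheorem7 {B : Type u} [CStarAlgebra B] [Nontrivial B] (θ : ℝ) (hθ : Irrational θ)
    (u v : unitary B)
    (huv : (v : B) * (u : B) = (alpha θ : ℂ) • ((u : B) * (v : B)))
    (f : C(Circle, ℂ)) (Y : Set Circle) (hY : Y = {z | f z = 0}) (hYne : Y.Nonempty)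
    (hφ : (∀ n : ℤ, n ≠ 0 → rot θ n Y ∩ Y = ∅) ∨
      (∀ ξ : Circle, (orb θ ξ ∩ Y).Subsingleton) ∨
      (⋃ n : ℕ, rot θ n Y) ∩ (⋃ k : ℕ, rot θ (-((k : ℤ) + 1)) Y) = ∅) :
    (∃ (θ' : ℝ) (γ : C(Circle, ℝ)), Irrational θ' ∧ 0 ≤ γ ∧
      Nonempty (StarAlgebra.elemental ℂ ((u : B) * fc v f) ≃⋆ₐ[ℂ] GenRotAlg.{u} θ' γ)) ∧
    (¬ Periodic (fun z => ‖f z‖) →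
      Nonempty (StarAlgebra.elemental ℂ ((u : B) * fc v f) ≃⋆ₐ[ℂ] GenRotAlg.{u} θ (absSq f))) ∧
    (Periodic (fun z => ‖f z‖) →
      ∃ (n : ℕ) (g : C(Circle, ℝ)), 2 ≤ n ∧
        (∀ ζ, IsPeriod (fun z => ‖f z‖) ζ ↔ ζ ^ n = 1) ∧
        0 ≤ g ∧ (∀ z, ‖f z‖ = g (z ^ n)) ∧
        Nonempty (StarAlgebra.elemental ℂ ((u : B) * fc v f) ≃⋆ₐ[ℂ] GenRotAlg.{u} (n * θ) (g ^ 2))) := by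
  have hzero : ∀ z, f z = 0 → ∀ k : ℤ, k ≠ 0 → f (alpha θ ^ k * z) ≠ 0 := fun z hz k hk => by
    subst hY
    exact notMem_of_orbit_condition hθ hφ hz hk
  have hR := relations_unitary_mul_fc huv f
  have hinj := fc_injective hθ huv
  have hnonper : ¬ Periodic (fun z => ‖f z‖) →
      Nonempty (StarAlgebra.elemental ℂ ((u : B) * fc v f) ≃⋆ₐ[ℂ] GenRotAlg.{u} θ (absSq f)) := by
    intro hp
    refine nonempty_elemental_equiv hθ hR hinj (fun z hz k hk => ?_) ?_
    · rw [Ne, absSq_eq_zero_iff]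
      exact hzero z (absSq_eq_zero_iff.mp hz) k hk
    · rintro ⟨ζ, hζ, hζp⟩
      exact hp ⟨ζ, hζ, (isPeriod_sq_iff (fun z => norm_nonneg (f z)) ζ).mp hζp⟩
  have hper : Periodic (fun z => ‖f z‖) →
      ∃ (n : ℕ) (g : C(Circle, ℝ)), 2 ≤ n ∧
        (∀ ζ, IsPeriod (fun z => ‖f z‖) ζ ↔ ζ ^ n = 1) ∧
        0 ≤ g ∧ (∀ z, ‖f z‖ = g (z ^ n)) ∧
        Nonempty (StarAlgebra.elemental ℂ ((u : B) * fc v f) ≃⋆ₐ[ℂ]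
          GenRotAlg.{u} (n * θ) (g ^ 2)) := by
    rintro ⟨ζ₀, hζ₀, hζ₀p⟩
    have hfc : Continuous fun z => ‖f z‖ := by fun_prop
    -- Not every rotation is a period, since `f` has a zero whose translate is not a zero.
    have hproper : periodGroup (fun z => ‖f z‖) ≠ ⊤ := fun htop => by
      obtain ⟨y, hy⟩ := hYne
      rw [hY] at hy
      have h1 : alpha θ ^ (1 : ℤ) ∈ periodGroup (fun z => ‖f z‖) := htop ▸ Subgroup.mem_top _
      have h2 : ‖f (alpha θ ^ (1 : ℤ) * y)‖ = ‖f y‖ := h1 y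
      rw [show f y = 0 from hy, norm_zero, norm_eq_zero] at h2
      exact hzero y hy 1 one_ne_zero h2
    obtain ⟨n, hn, hroots⟩ := exists_mem_iff_pow_eq_one (isClosed_periodGroup hfc) hproper
    replace hroots : ∀ ζ, IsPeriod (fun z => ‖f z‖) ζ ↔ ζ ^ n = 1 := hroots
    obtain ⟨g, hg⟩ := exists_eq_comp_pow hn hfc fun ζ hζ => (hroots ζ).mpr hζ
    have hsurj := circle_pow_surjective hn
    have hg0 : ∀ z, 0 ≤ g z := fun z => by
      obtain ⟨y, rfl⟩ := hsurj z
      exact (norm_nonneg _).trans_eq (hg y)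
    refine ⟨n, g, ?_, hroots, hg0, hg, ?_⟩
    · have hn1 : n ≠ 1 := fun h1 => hζ₀ (by simpa [h1] using (hroots ζ₀).mp hζ₀p)
      omega
    · have hRn : Relations (n * θ) (g ^ 2) ((u : B) * fc v f) (v ^ n) :=
        hR.pow n fun z => by simp [absSq, hg]
      refine nonempty_elemental_equiv (hθ.natCast_mul hn) hRn ?_ ?_ ?_
      · intro h₁ h₂ h12
        rw [fc_pow, fc_pow] at h12
        ext z
        obtain ⟨y, rfl⟩ := hsurj z
        exact DFunLike.congr_fun (hinj h12) y
      · intro z hz k hk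
        obtain ⟨y, rfl⟩ := hsurj z
        have hy : f y = 0 := by
          rw [← norm_eq_zero, hg]
          simpa using hz
        have h1 : alpha (n * θ) ^ k * y ^ n = (alpha θ ^ k * y) ^ n := by
          rw [alpha_natCast_mul, mul_pow, ← zpow_natCast, ← zpow_natCast (alpha θ ^ k), ← zpow_mul,
            ← zpow_mul, mul_comm (n : ℤ)]
        rw [ContinuousMap.pow_apply, h1, ← hg]
        exact pow_ne_zero 2 (norm_ne_zero_iff.mpr (hzero y hy k hk))
      · rintro ⟨ζ, hζ, hζp⟩
        obtain ⟨ξ, rfl⟩ := hsurj ζ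
        refine hζ ((hroots ξ).mp fun z => ?_)
        have h1 := (isPeriod_sq_iff hg0 _).mp hζp (z ^ n)
        simp only [hg, mul_pow]
        exact h1
  refine ⟨?_, hnonper, hper⟩
  by_cases hp : Periodic (fun z => ‖f z‖)
  · obtain ⟨n, g, hn, -, -, -, he⟩ := hper hp
    have hsq : 0 ≤ g ^ 2 := ContinuousMap.le_def.mpr fun z => by
      rw [ContinuousMap.pow_apply]
      exact sq_nonneg (g z)
    exact ⟨n * θ, g ^ 2, hθ.natCast_mul (by omega), hsq, he⟩
  · exact ⟨θ, absSq f, hθ, fun z => sq_nonneg ‖f z‖, hnonper hp⟩
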